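/- Let $X$ be a smooth manifold, let $\pi\in\Gamma(\wedge^2TX)$ be a Poisson structure on $X$, and let $(\mathcal A,[\cdot,\cdot]_{\mathcal A},\rho_{\mathcal A})$ be a Lie algebroid over $X$. For open $U\subseteq X$ put $\mathcal F_\pi(U)=\pi^\sharp(\Gamma(U,T^*X))$ and $\mathcal F_{\mathcal A}(U)=\rho_{\mathcal A}(\Gamma(U,\mathcal A))$. For a volume form $\mu$ on an open set $W$, the modular vector field $V_{\pi,\mu}$ is the vector field on $W$ with $\mathcal L_{\pi^\sharp(df)}\mu=(\mathcal L_{V_{\pi,\mu}}f)\,\mu$ for all $f\in C^\infty(W)$. The modular foliation $\mathcal F_{\pi,\mathrm{mod}}$ is the sheaf of $C^\infty_X$-submodules of the sheaf of vector fields on $X$ spanned by all local Hamiltonian vector fields $\pi^\sharp(df)$ and all local modular vector fields $V_{\pi,\mu}$. An orbit of $\mathcal A$ is a maximal connected immersed submanifold $\mathcal O$ of $X$ with $T_x\mathcal O=\operatorname{im}\rho_{\mathcal A,x}$ for all $x\in\mathcal O$. An immersed submanifold $N$ is $\pi$-Poisson if $\pi^\sharp(T_x^*X)\subseteq T_xN$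 for all $x\in N$. Suppose that $\pi$ is of $\mathcal A$-type, i.e. that it admits an $\mathcal A$-lift: there is $\pi_{\mathcal A}\in\Gamma(\wedge^2\mathcal A)$ with $\rho_{\mathcal A}(\pi_{\mathcal A})=\pi$ (it is not required that $[\pi_{\mathcal A},\pi_{\mathcal A}]_{\mathcal A}=0$). Then, for every open $U\subseteq X$ (in particular for $U=X$), $$\mathcal F_\pi(U)\subseteq\mathcal F_{\pi,\mathrm{mod}}(U)\subseteq\mathcal F_{\mathcal A}(U)=\rho_{\mathcal A}(\Gamma(U,\mathcal A))\subseteq\Gamma(U,TX),$$ and the orbits of $\mathcal A$ are $\pi$-Poisson submanifolds. -/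

import Mathlib

open scoped Manifold ContDiff

noncomputable section

namespace PoissonLift

/-! ### Linear algebra of bivectors -/

section LinearAlgebra

variable {M : Type*} [AddCommGroup M] [Module ℝ M]

/-- The decomposable bivector `v ∧ w`. -/
def wedge (v w : M) : ⋀[ℝ]^2 M := exteriorPower.ιMulti ℝ 2 ![v, w]

/-- The alternating map `(v, w) ↦ α(v) w - α(w) v`. -/
def contractAux (α : M →ₗ[ℝ] ℝ) : M [⋀^Fin 2]→ₗ[ℝ] M where
  toFun v := α (v 0) • v 1 - α (v 1) • v 0
  map_update_add' := by
    intro _ m i x y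
    fin_cases i <;> simp [add_smul, smul_add] <;> abel
  map_update_smul' := by
    intro _ m i c x
    fin_cases i <;> simp [smul_sub, smul_smul, mul_comm]
  map_eq_zero_of_eq' := by
    intro v i j h hij
    fin_cases i <;> fin_cases j <;> simp_all

/-- The contraction `p ↦ p♯(α) = ι_α p`, determined by `(v ∧ w)♯(α) = α(v) w - α(w) v`; it
satisfies `β (p♯(α)) = p(α, β)`. -/
def sharp (p : ⋀[ℝ]^2 M) (α : M →ₗ[ℝ] ℝ) : M :=
  exteriorPower.alternatingMapLinearEquiv (contractAux α) p

theorem sharp_wedge (v w : M) (α : M →ₗ[ℝ] ℝ) :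
    sharp (wedge v w) α = α v • w - α w • v := by
  simp [sharp, wedge, contractAux]

end LinearAlgebra

/-! ### Sections of vector bundles -/

section Bundle

variable (E : Type*) [NormedAddCommGroup E] [NormedSpace ℝ E]
  {X : Type*} [TopologicalSpace X] [ChartedSpace E X]
  (F : Type*) [NormedAddCommGroup F] [NormedSpace ℝ F]
  (V : X → Type*) [TopologicalSpace (Bundle.TotalSpace F V)]
  [∀ x, TopologicalSpace (V x)] [FiberBundle F V]

/-- `s` is a smooth section of `V` over `U`. Sections over a subset are represented by functions
on all of `X`, of which only the values on the subset matter. -/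
def IsSmoothSectionOn (s : ∀ x, V x) (U : Set X) : Prop :=
  ContMDiffOn 𝓘(ℝ, E) (𝓘(ℝ, E).prod 𝓘(ℝ, F)) ∞ (fun x => Bundle.TotalSpace.mk' F x (s x)) U

variable [∀ x, AddCommGroup (V x)] [∀ x, Module ℝ (V x)]

/-- `p` is a smooth section of `⋀² V` over `X`: near every point it is a finite sum of wedge
products of smooth local sections of `V`. -/
def IsSmoothBivector (p : ∀ x, ⋀[ℝ]^2 (V x)) : Prop :=
  ∀ x : X, ∃ W : Set X, IsOpen W ∧ x ∈ W ∧ ∃ (m : ℕ) (s t : Fin m → ∀ y, V y),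
    (∀ k, IsSmoothSectionOn E F V (s k) W) ∧ (∀ k, IsSmoothSectionOn E F V (t k) W) ∧
      ∀ y ∈ W, p y = ∑ k, wedge (s k y) (t k y)

end Bundle

/-! ### Vector fields, forms and Poisson structures on a manifold -/

section Manifold

variable {E : Type*} [NormedAddCommGroup E] [NormedSpace ℝ E]
  {X : Type*} [TopologicalSpace X] [ChartedSpace E X]

variable (E) in
/-- Smooth real-valued functions on `U`. -/
def IsSmoothFunctionOn (f : X → ℝ) (U : Set X) : Prop :=
  ContMDiffOn 𝓘(ℝ, E) 𝓘(ℝ, ℝ) ∞ f U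

/-- The differential `df` at `x`. -/
def differential (f : X → ℝ) (x : X) : TangentSpace 𝓘(ℝ, E) x →L[ℝ] ℝ :=
  mfderiv 𝓘(ℝ, E) 𝓘(ℝ, ℝ) f x

variable [IsManifold 𝓘(ℝ, E) ∞ X]

/-- Smooth vector fields on `U`, i.e. `Γ(U, TX)`. -/
def vectorFields (U : Set X) : Set (∀ x : X, TangentSpace 𝓘(ℝ, E) x) :=
  {Z | ContMDiffOn 𝓘(ℝ, E) 𝓘(ℝ, E).tangent ∞
    (fun x => (Bundle.TotalSpace.mk' E x (Z x) : TangentBundle 𝓘(ℝ, E) X)) U}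

/-- Smooth one-forms on `U`, i.e. smooth sections over `U` of the cotangent bundle. -/
def IsSmoothOneFormOn (α : ∀ x : X, TangentSpace 𝓘(ℝ, E) x →L[ℝ] ℝ) (U : Set X) : Prop :=
  ContMDiffOn 𝓘(ℝ, E) (𝓘(ℝ, E).prod 𝓘(ℝ, E →L[ℝ] ℝ)) ∞
    (fun x => Bundle.TotalSpace.mk' (E →L[ℝ] ℝ)
      (E := fun x : X => TangentSpace 𝓘(ℝ, E) x →L[ℝ] Bundle.Trivial X ℝ x) x (α x)) U

/-- A (pointwise) field of forms of top degree on `X`. -/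
abbrev TopForm (E : Type*) [NormedAddCommGroup E] [NormedSpace ℝ E]
    (X : Type*) [TopologicalSpace X] [ChartedSpace E X] : Type _ :=
  ∀ x : X, TangentSpace 𝓘(ℝ, E) x [⋀^Fin (Module.finrank ℝ E)]→ₗ[ℝ] ℝ

/-- `μ` is a volume form on `W`: a smooth nowhere vanishing form of top degree. -/
def IsVolumeFormOn (μ : TopForm E X) (W : Set X) : Prop :=
  (∀ Y : Fin (Module.finrank ℝ E) → ∀ x : X, TangentSpace 𝓘(ℝ, E) x,
    (∀ i, Y i ∈ vectorFields W) → IsSmoothFunctionOn E (fun x => μ x (fun i => Y i x)) W) ∧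
  ∀ x ∈ W, μ x ≠ 0

/-- The Lie derivative of a form of top degree, evaluated on vector fields:
`(L_Z μ)(Y₁, …, Yₙ) = Z(μ(Y₁, …, Yₙ)) - ∑ᵢ μ(Y₁, …, [Z, Yᵢ], …, Yₙ)`. -/
def lieDerivative (Z : ∀ x : X, TangentSpace 𝓘(ℝ, E) x) (μ : TopForm E X)
    (Y : Fin (Module.finrank ℝ E) → ∀ x : X, TangentSpace 𝓘(ℝ, E) x) (x : X) : ℝ :=
  differential (fun y => μ y (fun i => Y i y)) x (Z x) -
    ∑ i, μ x (Function.update (fun j => Y j x) i (VectorField.mlieBracket 𝓘(ℝ, E) Z (Y i) x))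

/-- A (pointwise) field of bivectors on `X`. -/
abbrev Bivector (E : Type*) [NormedAddCommGroup E] [NormedSpace ℝ E]
    (X : Type*) [TopologicalSpace X] [ChartedSpace E X] : Type _ :=
  ∀ x : X, ⋀[ℝ]^2 (TangentSpace 𝓘(ℝ, E) x)

/-- The vector field `π♯(df)`. -/
def hamiltonian (π : Bivector E X) (f : X → ℝ) (x : X) : TangentSpace 𝓘(ℝ, E) x :=
  sharp (π x) (differential (E := E) f x : TangentSpace 𝓘(ℝ, E) x →ₗ[ℝ] ℝ)

/-- The bracket of functions `{f, g} = π(df, dg) = dg(π♯(df))`. -/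
def poissonBracket (π : Bivector E X) (f g : X → ℝ) (x : X) : ℝ :=
  (differential g x : TangentSpace 𝓘(ℝ, E) x →L[ℝ] ℝ) (hamiltonian π f x)

/-- `π` is a Poisson structure on `X`: a smooth bivector field whose bracket of smooth functions
satisfies the Jacobi identity. -/
def IsPoisson (π : Bivector E X) : Prop :=
  IsSmoothBivector E E (fun x : X => TangentSpace 𝓘(ℝ, E) x) π ∧
  ∀ f g h : X → ℝ, IsSmoothFunctionOn E f Set.univ → IsSmoothFunctionOn E g Set.univ →
    IsSmoothFunctionOn E h Set.univ → ∀ x : X,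
      poissonBracket π f (poissonBracket π g h) x + poissonBracket π g (poissonBracket π h f) x +
        poissonBracket π h (poissonBracket π f g) x = 0

/-- `Z` is a Hamiltonian vector field of `π` on `W`. -/
def IsHamiltonianOn (π : Bivector E X) (Z : ∀ x : X, TangentSpace 𝓘(ℝ, E) x) (W : Set X) : Prop :=
  ∃ f : X → ℝ, IsSmoothFunctionOn E f W ∧ ∀ x ∈ W, Z x = hamiltonian π f x

/-- `Z` is the modular vector field of `π` on `W` associated to the volume form `μ`: for all smooth
functions `f` on `W` one has `L_{π♯(df)} μ = Z(f) μ`. -/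
def IsModularVectorFieldOn (π : Bivector E X) (μ : TopForm E X)
    (Z : ∀ x : X, TangentSpace 𝓘(ℝ, E) x) (W : Set X) : Prop :=
  Z ∈ vectorFields W ∧
  ∀ f : X → ℝ, IsSmoothFunctionOn E f W →
    ∀ Y : Fin (Module.finrank ℝ E) → ∀ x : X, TangentSpace 𝓘(ℝ, E) x,
      (∀ i, Y i ∈ vectorFields W) → ∀ x ∈ W,
        lieDerivative (hamiltonian π f) μ Y x =
          (differential f x : TangentSpace 𝓘(ℝ, E) x →L[ℝ] ℝ) (Z x) * μ x (fun i => Y i x)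

/-- The sections over `U` of the symplectic foliation `F_π = π♯(Γ(T*X))`. -/
def symplecticFoliation (π : Bivector E X) (U : Set X) :
    Set (∀ x : X, TangentSpace 𝓘(ℝ, E) x) :=
  {Z | ∃ α : ∀ x : X, TangentSpace 𝓘(ℝ, E) x →L[ℝ] ℝ, IsSmoothOneFormOn α U ∧
    ∀ x ∈ U, Z x = sharp (π x) (α x : TangentSpace 𝓘(ℝ, E) x →ₗ[ℝ] ℝ)}

/-- The sections over `U` of the modular foliation `F_{π,mod}`: the sheaf of `C^∞`-modules spanned
by the local Hamiltonian vector fields and the local modular vector fields of `π`. -/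
def modularFoliation (π : Bivector E X) (U : Set X) :
    Set (∀ x : X, TangentSpace 𝓘(ℝ, E) x) :=
  {Z | ∀ x ∈ U, ∃ W : Set X, IsOpen W ∧ x ∈ W ∧ W ⊆ U ∧
    ∃ (m : ℕ) (g : Fin m → X → ℝ) (Y : Fin m → ∀ y : X, TangentSpace 𝓘(ℝ, E) y),
      (∀ k, IsSmoothFunctionOn E (g k) W) ∧
      (∀ k, IsHamiltonianOn π (Y k) W ∨
        ∃ μ : TopForm E X, IsVolumeFormOn μ W ∧ IsModularVectorFieldOn π μ (Y k) W) ∧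
      ∀ y ∈ W, Z y = ∑ k, g k y • Y k y}

end Manifold

/-! ### Lie algebroids, lifts and orbits -/

/-- A Lie algebroid structure on the smooth vector bundle `V` over `X`: a smooth bundle map
`V → TX` over the identity (the anchor) and a Lie bracket on the smooth sections of `V` that
satisfies the Leibniz rule `[v, f w] = f [v, w] + (ρ(v) f) w`. -/
structure LieAlgebroid (E : Type*) [NormedAddCommGroup E] [NormedSpace ℝ E]
    {X : Type*} [TopologicalSpace X] [ChartedSpace E X] [IsManifold 𝓘(ℝ, E) ∞ X]
    (F : Type*) [NormedAddCommGroup F] [NormedSpace ℝ F]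
    (V : X → Type*) [TopologicalSpace (Bundle.TotalSpace F V)]
    [∀ x, AddCommGroup (V x)] [∀ x, Module ℝ (V x)] [∀ x, TopologicalSpace (V x)]
    [FiberBundle F V] [VectorBundle ℝ F V] where
  anchor : ∀ x : X, V x →ₗ[ℝ] TangentSpace 𝓘(ℝ, E) x
  smooth_anchor : ContMDiff (𝓘(ℝ, E).prod 𝓘(ℝ, F)) 𝓘(ℝ, E).tangent ∞
    (fun p : Bundle.TotalSpace F V =>
      (Bundle.TotalSpace.mk' E p.1 (anchor p.1 p.2) : TangentBundle 𝓘(ℝ, E) X))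
  bracket : Cₛ^∞⟮𝓘(ℝ, E); F, V⟯ → Cₛ^∞⟮𝓘(ℝ, E); F, V⟯ → Cₛ^∞⟮𝓘(ℝ, E); F, V⟯
  bracket_add : ∀ u v w, bracket u (v + w) = bracket u v + bracket u w
  bracket_smul : ∀ (c : ℝ) (u v), bracket u (c • v) = c • bracket u v
  bracket_skew : ∀ u v, bracket u v = -bracket v u
  jacobi : ∀ u v w,
    bracket u (bracket v w) + bracket v (bracket w u) + bracket w (bracket u v) = 0
  leibniz : ∀ (v w fw : Cₛ^∞⟮𝓘(ℝ, E); F, V⟯) (f : X → ℝ), IsSmoothFunctionOn E f Set.univ →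
    (∀ x, fw x = f x • w x) → ∀ x, bracket v fw x = f x • bracket v w x +
      (differential f x : TangentSpace 𝓘(ℝ, E) x →L[ℝ] ℝ) (anchor x (v x)) • w x

section Lift

variable {E : Type*} [NormedAddCommGroup E] [NormedSpace ℝ E]
  {X : Type*} [TopologicalSpace X] [ChartedSpace E X] [IsManifold 𝓘(ℝ, E) ∞ X]
  {F : Type*} [NormedAddCommGroup F] [NormedSpace ℝ F]
  {V : X → Type*} [TopologicalSpace (Bundle.TotalSpace F V)]
  [∀ x, AddCommGroup (V x)] [∀ x, Module ℝ (V x)] [∀ x, TopologicalSpace (V x)]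
  [FiberBundle F V] [VectorBundle ℝ F V]

/-- `π` admits an `A`-lift (is of `A`-type): there is a smooth section `πA` of `⋀² A` with
`ρ_A(πA) = π`. It is not required that `[πA, πA] = 0`, so lifts that are in addition
`A`-Poisson structures are included. -/
def LieAlgebroid.AdmitsLift (A : LieAlgebroid E F V) (π : Bivector E X) : Prop :=
  ∃ πA : ∀ x, ⋀[ℝ]^2 (V x), IsSmoothBivector E F V πA ∧
    ∀ x, exteriorPower.map 2 (A.anchor x) (πA x) = π x

/-- The sections over `U` of `F_A = ρ_A(Γ(A))`. -/
def LieAlgebroid.foliation (A : LieAlgebroid E F V) (U : Set X) :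
    Set (∀ x : X, TangentSpace 𝓘(ℝ, E) x) :=
  {Z | ∃ v : ∀ x, V x, IsSmoothSectionOn E F V v U ∧ ∀ x ∈ U, Z x = A.anchor x (v x)}

end Lift

universe u v

/-- An injectively immersed submanifold of `X`, given by an injective immersion `incl : N → X`. -/
structure ImmersedSubmanifold (E : Type v) [NormedAddCommGroup E] [NormedSpace ℝ E]
    (X : Type u) [TopologicalSpace X] [ChartedSpace E X] where
  N : Type u
  dim : ℕ
  [topologicalSpace : TopologicalSpace N]
  [t2Space : T2Space N]
  [secondCountable : SecondCountableTopology N]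
  [chartedSpace : ChartedSpace (EuclideanSpace ℝ (Fin dim)) N]
  [isManifold : IsManifold (𝓡 dim) ∞ N]
  incl : N → X
  injective : Function.Injective incl
  immersion : Manifold.IsImmersion (𝓡 dim) 𝓘(ℝ, E) ∞ incl

section Orbits

variable {E : Type v} [NormedAddCommGroup E] [NormedSpace ℝ E]
  {X : Type u} [TopologicalSpace X] [ChartedSpace E X]

/-- The tangent space of an immersed submanifold at a point, as a subspace of that of `X`. -/
def ImmersedSubmanifold.tangent (S : ImmersedSubmanifold E X) (p : S.N) :
    Submodule ℝ (TangentSpace 𝓘(ℝ, E) (S.incl p)) :=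
  letI := S.topologicalSpace
  letI := S.chartedSpace
  LinearMap.range (mfderiv (𝓡 S.dim) 𝓘(ℝ, E) S.incl p).toLinearMap

/-- `S` is a `π`-Poisson submanifold: `π♯(T*_x X) ⊆ T_x S` for all `x` in `S`. -/
def ImmersedSubmanifold.IsPoissonSubmanifold (S : ImmersedSubmanifold E X) (π : Bivector E X) :
    Prop :=
  ∀ (p : S.N) (α : TangentSpace 𝓘(ℝ, E) (S.incl p) →ₗ[ℝ] ℝ),
    sharp (π (S.incl p)) α ∈ S.tangent p

variable [IsManifold 𝓘(ℝ, E) ∞ X]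
  {F : Type*} [NormedAddCommGroup F] [NormedSpace ℝ F]
  {V : X → Type*} [TopologicalSpace (Bundle.TotalSpace F V)]
  [∀ x, AddCommGroup (V x)] [∀ x, Module ℝ (V x)] [∀ x, TopologicalSpace (V x)]
  [FiberBundle F V] [VectorBundle ℝ F V]

/-- `S` is connected and `T_x S = im ρ_{A,x}` for all `x` in `S`. -/
def LieAlgebroid.IsIntegral (A : LieAlgebroid E F V) (S : ImmersedSubmanifold E X) : Prop :=
  (letI := S.topologicalSpace
   ConnectedSpace S.N) ∧
  ∀ p : S.N, S.tangent p = LinearMap.range (A.anchor (S.incl p))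

/-- `S` is an orbit of `A`: a maximal connected immersed submanifold with `T_x S = im ρ_{A,x}`
for all `x` in `S`. -/
def LieAlgebroid.IsOrbit (A : LieAlgebroid E F V) (S : ImmersedSubmanifold E X) : Prop :=
  A.IsIntegral S ∧
  ∀ S' : ImmersedSubmanifold E X, A.IsIntegral S' →
    Set.range S.incl ⊆ Set.range S'.incl → Set.range S'.incl = Set.range S.incl

end Orbits

end PoissonLift

end

section

open Bundle Set Filter Topology

namespace PoissonLift

/-! ### Contraction of bivectors and a trace identity for top-degree forms -/

section LinearAlgebra

variable {M N : Type*} [AddCommGroup M] [Module ℝ M] [AddCommGroup N] [Module ℝ N]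

/-! Near a point the lift gives `π = ∑ ρ(u_k) ∧ ρ(v_k)` with sections `u_k`, `v_k` of the algebroid.
Write `u f` for `ρ(u) f`. Then `π♯(df) = ∑ (u_k f) ρ(v_k) - (v_k f) ρ(u_k)`, which is visibly in the
image of the anchor. For a volume form `μ`, let `div w` be the factor in `L_{ρ(w)} μ = (div w) μ`.
The rule `L_{hZ} μ = h L_Z μ + (Z h) μ` (`lieDerivative_smul`) gives `L_{π♯(df)} μ = ∑ ((u_k f) div
v_k - (v_k f) div u_k + v_k (u_k f) - u_k (v_k f)) μ`. The second-order terms combine to `-ρ([u_k,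
v_k]) f` (`act_bracket`), so the modular vector field is the anchor of `∑ (div v_k) u_k - (div u_k)
v_k - [u_k, v_k]`.

These local preimages are glued by a partition of unity
(`exists_isSmoothSectionOn_forall_mem_convex`), since preimages of a vector under the anchor form a
convex set. The inclusion of the symplectic foliation comes from writing a one-form in coordinate
differentials. The claim on orbits is pointwise: contraction is natural (`sharp_map`), so `π♯(α)`
lies in the image of the anchor. -/

theorem sharp_sum {ι : Type*} (s : Finset ι) (p : ι → ⋀[ℝ]^2 M) (α : M →ₗ[ℝ] ℝ) :
    sharp (∑ i ∈ s, p i) α = ∑ i ∈ s, sharp (p i) α := by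
  simp [sharp]

theorem sharp_add_right (p : ⋀[ℝ]^2 M) (α β : M →ₗ[ℝ] ℝ) :
    sharp p (α + β) = sharp p α + sharp p β := by
  have h : contractAux (α + β) = contractAux α + contractAux β := by
    ext v
    simp [contractAux, add_smul]
    abel
  simp [sharp, h]

theorem sharp_smul_right (p : ⋀[ℝ]^2 M) (c : ℝ) (α : M →ₗ[ℝ] ℝ) :
    sharp p (c • α) = c • sharp p α := by
  have h : contractAux (c • α) = c • contractAux α := by
    ext v
    simp [contractAux, smul_sub, mul_smul]
  simp [sharp, h]

theorem sharp_sum_smul_right {ι : Type*} (s : Finset ι) (p : ⋀[ℝ]^2 M) (c : ι → ℝ)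
    (α : ι → M →ₗ[ℝ] ℝ) :
    sharp p (∑ i ∈ s, c i • α i) = ∑ i ∈ s, c i • sharp p (α i) := by
  let L : (M →ₗ[ℝ] ℝ) →ₗ[ℝ] M :=
    { toFun := sharp p
      map_add' := sharp_add_right p
      map_smul' := sharp_smul_right p }
  change L _ = ∑ i ∈ s, c i • L (α i)
  simp

theorem map_wedge (ρ : M →ₗ[ℝ] N) (v w : M) :
    exteriorPower.map 2 ρ (wedge v w) = wedge (ρ v) (ρ w) := by
  simp only [wedge, exteriorPower.map_apply_ιMulti]
  congr 1
  ext i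
  fin_cases i <;> rfl

/-- Contraction of bivectors is natural in the vector space. -/
theorem sharp_map (ρ : M →ₗ[ℝ] N) (p : ⋀[ℝ]^2 M) (α : N →ₗ[ℝ] ℝ) :
    sharp (exteriorPower.map 2 ρ p) α = ρ (sharp p (α ∘ₗ ρ)) := by
  have h : (exteriorPower.alternatingMapLinearEquiv (contractAux α)) ∘ₗ exteriorPower.map 2 ρ =
      ρ ∘ₗ exteriorPower.alternatingMapLinearEquiv (contractAux (α ∘ₗ ρ)) := by
    ext v
    simp [contractAux]
  exact LinearMap.congr_fun h p

/-- The trace identity `∑ᵢ φ(eᵢ) μ(…, z, …) = φ(z) μ(e)`, where `z` is in the `i`-th slot. -/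
theorem sum_smul_alternating_update {ι : Type*} [Fintype ι] [DecidableEq ι]
    (e : Module.Basis ι ℝ M) (μ : M [⋀^ι]→ₗ[ℝ] ℝ) (φ : M →ₗ[ℝ] ℝ) (z : M) :
    ∑ i, φ (e i) * μ (Function.update e i z) = φ z * μ e := by
  -- Both sides are linear in `z`. At `z = e j` every term with `i ≠ j` has `e j` in two slots and
  -- vanishes.
  have h : ∑ i, φ (e i) • (μ.toMultilinearMap.toLinearMap e i) = μ e • φ := by
    refine e.ext fun j => ?_
    simp only [LinearMap.sum_apply, LinearMap.smul_apply, MultilinearMap.toLinearMap_apply,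
      smul_eq_mul, AlternatingMap.coe_multilinearMap]
    rw [Finset.sum_eq_single j]
    · simp [mul_comm]
    · intro i _ hij
      rw [μ.map_update_self e hij, mul_zero]
    · simp
  simpa [mul_comm] using LinearMap.congr_fun h z

end LinearAlgebra

/-! ### Extension and gluing of smooth sections -/

section Sections

variable {E : Type*} [NormedAddCommGroup E] [NormedSpace ℝ E] [FiniteDimensional ℝ E]
  {X : Type*} [TopologicalSpace X] [T2Space X] [ChartedSpace E X] [IsManifold 𝓘(ℝ, E) ∞ X]
  {F : Type*} [NormedAddCommGroup F] [NormedSpace ℝ F]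
  {V : X → Type*} [TopologicalSpace (TotalSpace F V)]
  [∀ x, AddCommGroup (V x)] [∀ x, Module ℝ (V x)] [∀ x, TopologicalSpace (V x)]
  [FiberBundle F V] [VectorBundle ℝ F V]

/-- A smooth local section agrees near a given point with a global smooth section. -/
theorem exists_contMDiffSection_eventuallyEq {s : ∀ x, V x} {W : Set X} (hW : IsOpen W)
    (hs : IsSmoothSectionOn E F V s W) {x : X} (hx : x ∈ W) :
    ∃ σ : Cₛ^∞⟮𝓘(ℝ, E); F, V⟯, ∀ᶠ y in 𝓝 x, σ y = s y := by
  obtain ⟨f, -, hf⟩ := (SmoothBumpFunction.nhds_basis_tsupport (I := 𝓘(ℝ, E)) x).mem_iff.1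
    (hW.mem_nhds hx)
  refine ⟨⟨(f : X → ℝ) • s, ContMDiffOn.smul_section_of_tsupport f.contMDiff.contMDiffOn hW hf hs⟩,
    ?_⟩
  filter_upwards [f.eventuallyEq_one] with y hy
  change f y • s y = s y
  rw [hy, Pi.one_apply, one_smul]

/-- Every covector is the differential of a global smooth function. -/
theorem exists_differential_eq (x : X) (ℓ : TangentSpace 𝓘(ℝ, E) x →L[ℝ] ℝ) :
    ∃ f : X → ℝ, ContMDiff 𝓘(ℝ, E) 𝓘(ℝ, ℝ) ∞ f ∧ differential f x = ℓ := by
  obtain ⟨χ⟩ : Nonempty (SmoothBumpFunction 𝓘(ℝ, E) x) := inferInstance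
  let ℓ' : E →L[ℝ] ℝ := ℓ
  have hc : ContMDiffOn 𝓘(ℝ, E) 𝓘(ℝ, ℝ) ∞ (ℓ' ∘ extChartAt 𝓘(ℝ, E) x) (chartAt E x).source :=
    ℓ'.contMDiff.comp_contMDiffOn contMDiffOn_extChartAt
  refine ⟨fun y => χ y • (ℓ' ∘ extChartAt 𝓘(ℝ, E) x) y, χ.contMDiff_smul hc, ?_⟩
  have heq : (fun y => χ y • (ℓ' ∘ extChartAt 𝓘(ℝ, E) x) y) =ᶠ[𝓝 x]
      (ℓ' ∘ extChartAt 𝓘(ℝ, E) x) := by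
    filter_upwards [χ.eventuallyEq_one] with y hy
    simp [hy]
  rw [differential, heq.mfderiv_eq, mfderiv_comp x ℓ'.mdifferentiableAt
    (mdifferentiableAt_extChartAt (mem_chart_source E x)), mfderiv_extChartAt_self,
    ContinuousLinearMap.mfderiv_eq]
  rfl

/-- Tangent vectors are separated by the differentials of global smooth functions. -/
theorem tangent_ext {x : X} {v w : TangentSpace 𝓘(ℝ, E) x}
    (h : ∀ f : X → ℝ, ContMDiff 𝓘(ℝ, E) 𝓘(ℝ, ℝ) ∞ f →
      differential f x v = differential f x w) : v = w := by
  by_contra hvw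
  obtain ⟨ℓ, hℓ⟩ := SeparatingDual.exists_separating_of_ne (R := ℝ) (V := E) hvw
  refine hℓ ?_
  obtain ⟨f, hf, rfl⟩ := exists_differential_eq x ℓ
  exact h f hf

/-- Local smooth sections with values in convex sets can be glued over an open set. -/
theorem exists_isSmoothSectionOn_forall_mem_convex [SecondCountableTopology X] {U : Set X}
    (hU : IsOpen U) (t : ∀ x, Set (V x)) (ht : ∀ x, Convex ℝ (t x))
    (hloc : ∀ x ∈ U, ∃ W : Set X, IsOpen W ∧ x ∈ W ∧ ∃ s : ∀ x, V x,
      IsSmoothSectionOn E F V s W ∧ ∀ y ∈ W, s y ∈ t y) :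
    ∃ s : ∀ x, V x, IsSmoothSectionOn E F V s U ∧ ∀ x ∈ U, s x ∈ t x := by
  classical
  -- The gluing theorem for whole manifolds is applied to `U` as a manifold of its own, with `V`
  -- pulled back along the inclusion.
  let O : TopologicalSpace.Opens X := ⟨U, hU⟩
  let ι : C(O, X) := ⟨Subtype.val, continuous_subtype_val⟩
  have : LocallyCompactSpace X := Manifold.locallyCompact_of_finiteDimensional 𝓘(ℝ, E)
  have : LocallyCompactSpace O := hU.locallyCompactSpace
  let _ : ∀ x, AddCommGroup ((ι *ᵖ V) x) := fun x => inferInstanceAs (AddCommGroup (V (ι x)))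
  have key := exists_contMDiffSection_forall_mem_convex_of_local (n := ⊤) 𝓘(ℝ, E)
    (ι *ᵖ V) (F_fiber := F) (fun x : O => t x) (fun x => ht x) ?_
  · obtain ⟨s, hs⟩ := key
    refine ⟨fun x => if h : x ∈ U then (s ⟨x, h⟩ : V x) else 0, ?_, fun x hx => ?_⟩
    · intro x hx
      refine ContMDiffAt.contMDiffWithinAt ?_
      rw [contMDiffAt_section]
      refine (contMDiffAt_subtype_iff (U := O) (x := ⟨x, hx⟩)).1 ?_
      have := (contMDiffAt_section _).1 (s.contMDiff ⟨x, hx⟩)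
      refine this.congr_of_eventuallyEq (Eventually.of_forall fun y => ?_)
      have hy : (if h : (y : X) ∈ U then (s ⟨y, h⟩ : V y) else 0) = s y := dif_pos y.2
      exact congrArg (fun v : V y => (trivializationAt F V x ⟨y, v⟩).2) hy
    · have hs' : (if h : x ∈ U then (s ⟨x, h⟩ : V x) else 0) = s ⟨x, hx⟩ := dif_pos hx
      exact Set.mem_of_eq_of_mem hs' (hs ⟨x, hx⟩)
  · rintro ⟨x, hx⟩
    obtain ⟨W, hW, hxW, s, hs, hst⟩ := hloc x hx
    refine ⟨Subtype.val ⁻¹' W, (hW.preimage continuous_subtype_val).mem_nhds hxW,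
      fun y => s y, ?_, fun y hy => hst y hy⟩
    rintro y hy
    refine ContMDiffAt.contMDiffWithinAt ?_
    refine (contMDiffAt_section (E := ι *ᵖ V) (s := fun y => s (ι y)) y).2 ?_
    have := (contMDiffAt_section _).1 ((hs y hy).contMDiffAt (hW.mem_nhds hy))
    exact (contMDiffAt_subtype_iff (U := O) (x := y)).2 this

end Sections

end PoissonLift

end

noncomputable section

open Set Filter Topology
open Bundle (TotalSpace Trivialization)

namespace PoissonLift

/-! ### Smoothness of derivatives and brackets of vector fields -/

section VectorFields

variable {E : Type*} [NormedAddCommGroup E] [NormedSpace ℝ E]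
  {X : Type*} [TopologicalSpace X] [ChartedSpace E X] [IsManifold 𝓘(ℝ, E) ∞ X]

/-- The derivative of a smooth function along a smooth vector field is smooth. -/
theorem isSmoothFunctionOn_differential {f : X → ℝ} {Z : ∀ x : X, TangentSpace 𝓘(ℝ, E) x}
    {W : Set X} (hW : IsOpen W) (hf : IsSmoothFunctionOn E f W) (hZ : Z ∈ vectorFields W) :
    IsSmoothFunctionOn E (fun x => differential f x (Z x)) W := by
  have h := (contMDiff_snd_tangentBundle_modelSpace ℝ 𝓘(ℝ, ℝ) (n := ∞)).comp_contMDiffOn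
    ((hf.contMDiffOn_tangentMapWithin (m := ∞) le_rfl hW.uniqueMDiffOn).comp hZ fun x hx => hx)
  refine h.congr fun x hx => ?_
  change _ = mfderivWithin 𝓘(ℝ, E) 𝓘(ℝ, ℝ) f W x (Z x)
  rw [mfderivWithin_of_isOpen hW hx]
  rfl

theorem vectorFields_mono {Z : ∀ x : X, TangentSpace 𝓘(ℝ, E) x} {W W' : Set X}
    (hZ : Z ∈ vectorFields W) (h : W' ⊆ W) : Z ∈ vectorFields W' :=
  ContMDiffOn.mono hZ h

theorem mem_vectorFields_mlieBracket [CompleteSpace E] {Y Z : ∀ x : X, TangentSpace 𝓘(ℝ, E) x}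
    {W : Set X} (hW : IsOpen W) (hY : Y ∈ vectorFields W) (hZ : Z ∈ vectorFields W) :
    VectorField.mlieBracket 𝓘(ℝ, E) Y Z ∈ vectorFields W := by
  have : IsManifold 𝓘(ℝ, E) (minSmoothness ℝ 3) X :=
    IsManifold.of_le (n := ∞) (by
    simpa using (WithTop.coe_le_coe.2 (le_top : (3 : ℕ∞) ≤ ⊤)))
  have : IsManifold 𝓘(ℝ, E) (((⊤ : ℕ∞) : ℕ∞ω) + 1) X := by simpa
  intro x hx
  exact (ContMDiffAt.mlieBracket_vectorField (n := ⊤) (m := ⊤)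
    ((hY x hx).contMDiffAt (hW.mem_nhds hx)) ((hZ x hx).contMDiffAt (hW.mem_nhds hx))
    (by simp)).contMDiffWithinAt

end VectorFields

/-! ### The anchor and the bracket of a Lie algebroid -/

section LieAlgebroid

variable {E : Type*} [NormedAddCommGroup E] [NormedSpace ℝ E]
  {X : Type*} [TopologicalSpace X] [ChartedSpace E X] [IsManifold 𝓘(ℝ, E) ∞ X]
  {F : Type*} [NormedAddCommGroup F] [NormedSpace ℝ F]
  {V : X → Type*} [TopologicalSpace (TotalSpace F V)]
  [∀ x, AddCommGroup (V x)] [∀ x, Module ℝ (V x)] [∀ x, TopologicalSpace (V x)]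
  [FiberBundle F V] [VectorBundle ℝ F V]

namespace LieAlgebroid

variable (A : LieAlgebroid E F V)

theorem anchor_mem_vectorFields {v : ∀ x, V x} {U : Set X} (hv : IsSmoothSectionOn E F V v U) :
    (fun x => A.anchor x (v x)) ∈ vectorFields U :=
  A.smooth_anchor.comp_contMDiffOn hv

theorem foliation_subset_vectorFields (U : Set X) : A.foliation U ⊆ vectorFields U := by
  rintro Z ⟨v, hv, hZ⟩
  refine ContMDiffOn.congr (A.anchor_mem_vectorFields hv) fun x hx => ?_
  rw [hZ x hx]

/-- Integral submanifolds of the anchor are Poisson submanifolds of every bivector with a lift. -/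
theorem isPoissonSubmanifold {π : Bivector E X}
    (hlift : A.AdmitsLift π) {S : ImmersedSubmanifold E X} (hS : A.IsIntegral S) :
    S.IsPoissonSubmanifold π := by
  obtain ⟨p, -, hp⟩ := hlift
  intro x α
  rw [hS.2 x, ← hp, sharp_map]
  exact LinearMap.mem_range_self _ _

/-- The derivative of a function along the anchor of a section. -/
def act (u : ∀ x, V x) (f : X → ℝ) (x : X) : ℝ :=
  (differential f x : TangentSpace 𝓘(ℝ, E) x →L[ℝ] ℝ) (A.anchor x (u x))

theorem contMDiff_act (u : Cₛ^∞⟮𝓘(ℝ, E); F, V⟯) {f : X → ℝ}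
    (hf : ContMDiff 𝓘(ℝ, E) 𝓘(ℝ, ℝ) ∞ f) : ContMDiff 𝓘(ℝ, E) 𝓘(ℝ, ℝ) ∞ (A.act u f) :=
  contMDiffOn_univ.1 (isSmoothFunctionOn_differential isOpen_univ hf.contMDiffOn
    (A.anchor_mem_vectorFields u.contMDiff.contMDiffOn))

/-- The product of a smooth function and a smooth section. -/
def smulSection {f : X → ℝ} (hf : ContMDiff 𝓘(ℝ, E) 𝓘(ℝ, ℝ) ∞ f) (w : Cₛ^∞⟮𝓘(ℝ, E); F, V⟯) :
    Cₛ^∞⟮𝓘(ℝ, E); F, V⟯ :=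
  ⟨f • ⇑w, hf.smul_section w.contMDiff⟩

theorem bracket_smulSection (u w : Cₛ^∞⟮𝓘(ℝ, E); F, V⟯) {f : X → ℝ}
    (hf : ContMDiff 𝓘(ℝ, E) 𝓘(ℝ, ℝ) ∞ f) :
    A.bracket u (smulSection hf w) =
      smulSection hf (A.bracket u w) + smulSection (A.contMDiff_act u hf) w := by
  ext x
  exact A.leibniz u w (smulSection hf w) f hf.contMDiffOn (fun _ => rfl) x

theorem bracket_neg (u w : Cₛ^∞⟮𝓘(ℝ, E); F, V⟯) : A.bracket u (-w) = -A.bracket u w := by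
  simpa using A.bracket_smul (-1) u w

/-- The anchor is compatible with brackets: `ρ([u, v]) f = ρ(u)(ρ(v) f) - ρ(v)(ρ(u) f)`. -/
theorem act_bracket [FiniteDimensional ℝ E] [T2Space X] [ContMDiffVectorBundle ∞ F V 𝓘(ℝ, E)]
    (u v : Cₛ^∞⟮𝓘(ℝ, E); F, V⟯) {f : X → ℝ}
    (hf : ContMDiff 𝓘(ℝ, E) 𝓘(ℝ, ℝ) ∞ f) (x : X) :
    A.act (A.bracket u v) f x = A.act u (A.act v f) x - A.act v (A.act u f) x := by
  -- Expand the Jacobi identity for `u`, `v`, `f w` by Leibniz. The terms with undifferentiated `f`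
  -- cancel by Jacobi for `u`, `v`, `w`, those with one derivative of `f` along `u` or `v` cancel in
  -- pairs, and the defect of the claim times `w` remains.
  have key : ∀ w : Cₛ^∞⟮𝓘(ℝ, E); F, V⟯,
      (A.act u (A.act v f) x - A.act v (A.act u f) x - A.act (A.bracket u v) f x) • w x = 0 := by
    intro w
    have h := A.jacobi u v (smulSection hf w)
    have h0 := A.jacobi u v w
    rw [A.bracket_skew (smulSection hf w) u, A.bracket_skew (smulSection hf w), A.bracket_neg,
      A.bracket_smulSection, A.bracket_smulSection, A.bracket_smulSection, A.bracket_add,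
      A.bracket_add, A.bracket_smulSection, A.bracket_smulSection, A.bracket_smulSection,
      A.bracket_smulSection] at h
    rw [A.bracket_skew w u, A.bracket_skew w, A.bracket_neg] at h0
    have hx := congrArg (fun s : Cₛ^∞⟮𝓘(ℝ, E); F, V⟯ => s x) h
    have h0x := congrArg (fun s : Cₛ^∞⟮𝓘(ℝ, E); F, V⟯ => s x) h0
    simp only [ContMDiffSection.coe_add, ContMDiffSection.coe_neg, ContMDiffSection.coe_zero,
      Pi.add_apply, Pi.neg_apply, Pi.zero_apply, smulSection, ContMDiffSection.coeFn_mk,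
      Pi.smul_apply', ] at hx h0x
    have h1 : A.bracket u (A.bracket v w) x =
        A.bracket v (A.bracket u w) x + A.bracket (A.bracket u v) w x := by
      rw [← sub_eq_zero, ← h0x]
      abel
    rw [h1] at hx
    rw [← hx]
    module
  -- The scalar can be cancelled only against a section that is nonzero at `x`. If the fibre is
  -- zero, all the anchored vectors at `x` vanish.
  by_cases hV : ∃ w₀ : V x, w₀ ≠ 0
  · obtain ⟨w₀, hw₀⟩ := hV
    obtain ⟨W, hW, hs⟩ := FiberBundle.exists_contMDiffOn_extend 𝓘(ℝ, E) F (k := ∞) w₀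
    obtain ⟨W', hW', hWo, hx⟩ := mem_nhds_iff.1 hW
    obtain ⟨w, hw⟩ := exists_contMDiffSection_eventuallyEq (E := E) (F := F) hWo (hs.mono hW') hx
    have h := key w
    rw [hw.self_of_nhds, FiberBundle.extend_apply_self, smul_eq_zero_iff_left hw₀] at h
    linarith
  · push Not at hV
    simp [act, hV]

end LieAlgebroid

end LieAlgebroid

/-! ### The symplectic foliation inside the modular foliation -/

section SymplecticFoliation

variable {E : Type*} [NormedAddCommGroup E] [NormedSpace ℝ E] [FiniteDimensional ℝ E]
  {X : Type*} [TopologicalSpace X] [ChartedSpace E X] [IsManifold 𝓘(ℝ, E) ∞ X]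

/-- In a chart `α = ∑ α(∂_k) dx_k`, hence `π♯(α) = ∑ α(∂_k) π♯(dx_k)`; Hamiltonian generators
suffice. -/
theorem symplecticFoliation_subset_modularFoliation (π : Bivector E X) {U : Set X}
    (hU : IsOpen U) : symplecticFoliation π U ⊆ modularFoliation π U := by
  rintro Z ⟨α, hα, hZ⟩ x hx
  let b := Module.finBasis ℝ E
  let e := trivializationAt E (TangentSpace 𝓘(ℝ, E) : X → Type _) x
  have he : e.baseSet = (chartAt E x).source := TangentBundle.trivializationAt_baseSet x
  refine ⟨U ∩ (chartAt E x).source, hU.inter (chartAt E x).open_source,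
    ⟨hx, mem_chart_source E x⟩, inter_subset_left, _,
    fun k y => α y (e.localFrame b k y),
    fun k => hamiltonian π (fun y => b.coord k (extChartAt 𝓘(ℝ, E) x y)), fun k => ?_,
    fun k => .inl ⟨_, ?_, fun _ _ => rfl⟩, fun y hy => ?_⟩
  · have hs : ContMDiffOn 𝓘(ℝ, E) 𝓘(ℝ, E).tangent ∞ (fun y => (TotalSpace.mk' E y
        (e.localFrame b k y) : TangentBundle 𝓘(ℝ, E) X)) (U ∩ (chartAt E x).source) :=
      (e.contMDiffOn_localFrame_baseSet ∞ b k).mono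
        (he.symm ▸ (inter_subset_right : U ∩ (chartAt E x).source ⊆ _))
    have h := (hα.mono inter_subset_left).clm_bundle_apply hs
    intro y hy
    exact (Bundle.contMDiffWithinAt_section).1 (h y hy)
  · exact (LinearMap.toContinuousLinearMap (b.coord k)).contMDiff.comp_contMDiffOn
      (contMDiffOn_extChartAt.mono inter_subset_right)
  -- The tangent trivialization at `x` is the derivative of the chart at `x`, so the coordinate
  -- differentials are dual to its local frame.
  · have hdf : ∀ k, (differential (E := E) (fun y => b.coord k (extChartAt 𝓘(ℝ, E) x y)) y :
        TangentSpace 𝓘(ℝ, E) y →ₗ[ℝ] ℝ) = (e.basisAt b (he ▸ hy.2)).coord k := by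
      intro k
      let L : E →L[ℝ] ℝ := LinearMap.toContinuousLinearMap (b.coord k)
      have h1 : differential (E := E) (fun y => b.coord k (extChartAt 𝓘(ℝ, E) x y)) y =
          L ∘L (mfderiv 𝓘(ℝ, E) 𝓘(ℝ, E) (extChartAt 𝓘(ℝ, E) x) y) := by
        change mfderiv 𝓘(ℝ, E) 𝓘(ℝ, ℝ) (L ∘ extChartAt 𝓘(ℝ, E) x) y = _
        rw [mfderiv_comp y L.mdifferentiableAt (mdifferentiableAt_extChartAt hy.2),
          ContinuousLinearMap.mfderiv_eq]
        rfl
      rw [h1, ← TangentBundle.continuousLinearMapAt_trivializationAt hy.2]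
      ext v
      have hyb : y ∈ e.baseSet := he ▸ hy.2
      simp [L, Trivialization.basisAt, e, hyb, -TangentBundle.trivializationAt_baseSet]
    rw [hZ y hy.1]
    simp only [hamiltonian, hdf]
    rw [← sharp_sum_smul_right]
    congr 1
    refine (e.basisAt b (he ▸ hy.2)).ext fun i => ?_
    simp [he ▸ hy.2, Finsupp.single_apply]

end SymplecticFoliation

/-! ### Lie derivatives of top-degree forms -/

section LieDerivative

variable {E : Type*} [NormedAddCommGroup E] [NormedSpace ℝ E]
  {X : Type*} [TopologicalSpace X] [ChartedSpace E X] [IsManifold 𝓘(ℝ, E) ∞ X]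

theorem mdifferentiableAt_of_mem_vectorFields {Z : ∀ x : X, TangentSpace 𝓘(ℝ, E) x} {W : Set X}
    (hW : IsOpen W) (hZ : Z ∈ vectorFields W) {x : X} (hx : x ∈ W) :
    MDifferentiableAt 𝓘(ℝ, E) 𝓘(ℝ, E).tangent
      (fun x => (TotalSpace.mk' E x (Z x) : TangentBundle 𝓘(ℝ, E) X)) x :=
  ((hZ x hx).contMDiffAt (hW.mem_nhds hx)).mdifferentiableAt (by simp)

omit [IsManifold 𝓘(ℝ, E) ∞ X] in
theorem lieDerivative_congr {Z Z' : ∀ x : X, TangentSpace 𝓘(ℝ, E) x} {x : X}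
    (h : ∀ᶠ y in 𝓝 x, Z y = Z' y) (μ : TopForm E X)
    (Y : Fin (Module.finrank ℝ E) → ∀ x : X, TangentSpace 𝓘(ℝ, E) x) :
    lieDerivative Z μ Y x = lieDerivative Z' μ Y x := by
  simp only [lieDerivative, h.self_of_nhds,
    fun i => EventuallyEq.mlieBracket_vectorField_eq (I := 𝓘(ℝ, E)) h
      (EventuallyEq.refl (𝓝 x) (Y i))]

omit [IsManifold 𝓘(ℝ, E) ∞ X] in
theorem lieDerivative_zero (μ : TopForm E X)
    (Y : Fin (Module.finrank ℝ E) → ∀ x : X, TangentSpace 𝓘(ℝ, E) x) (x : X) :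
    lieDerivative 0 μ Y x = 0 := by
  simp [lieDerivative]

/-- The Lie derivative of a smooth volume form along a smooth vector field is smooth. -/
theorem isSmoothFunctionOn_lieDerivative [CompleteSpace E]
    {Z : ∀ x : X, TangentSpace 𝓘(ℝ, E) x} {μ : TopForm E X}
    {Y : Fin (Module.finrank ℝ E) → ∀ x : X, TangentSpace 𝓘(ℝ, E) x} {W : Set X}
    (hW : IsOpen W) (hμ : IsVolumeFormOn μ W) (hZ : Z ∈ vectorFields W)
    (hY : ∀ i, Y i ∈ vectorFields W) :
    IsSmoothFunctionOn E (lieDerivative Z μ Y) W := by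
  refine (isSmoothFunctionOn_differential hW (hμ.1 Y hY) hZ).sub
    (contMDiffOn_finsetSum fun i _ => ?_)
  -- Replacing `Y i` by `[Z, Y i]` yields another tuple of smooth fields, on which `μ` is smooth by
  -- definition.
  have h := hμ.1 (Function.update Y i (VectorField.mlieBracket 𝓘(ℝ, E) Z (Y i))) fun j => by
    rcases eq_or_ne j i with rfl | hj
    · simpa using mem_vectorFields_mlieBracket hW hZ (hY j)
    · simpa [hj] using hY j
  refine h.congr fun x _ => congrArg (μ x) ?_
  ext j
  rcases eq_or_ne j i with rfl | hj
  · simp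
  · simp [hj]

theorem lieDerivative_add {Z Z' : ∀ x : X, TangentSpace 𝓘(ℝ, E) x} {x : X} [CompleteSpace E]
    (hZ : MDifferentiableAt 𝓘(ℝ, E) 𝓘(ℝ, E).tangent
      (fun x => (TotalSpace.mk' E x (Z x) : TangentBundle 𝓘(ℝ, E) X)) x)
    (hZ' : MDifferentiableAt 𝓘(ℝ, E) 𝓘(ℝ, E).tangent
      (fun x => (TotalSpace.mk' E x (Z' x) : TangentBundle 𝓘(ℝ, E) X)) x) (μ : TopForm E X)
    (Y : Fin (Module.finrank ℝ E) → ∀ x : X, TangentSpace 𝓘(ℝ, E) x) :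
    lieDerivative (Z + Z') μ Y x = lieDerivative Z μ Y x + lieDerivative Z' μ Y x := by
  have : IsManifold 𝓘(ℝ, E) 2 X := IsManifold.of_le (n := ∞)
    (WithTop.coe_le_coe.2 (le_top : (2 : ℕ∞) ≤ ⊤))
  simp only [lieDerivative, VectorField.mlieBracket_add_left (I := 𝓘(ℝ, E)) hZ hZ', Pi.add_apply,
    map_add, AlternatingMap.map_update_add, Finset.sum_add_distrib]
  ring

/-- `L_{hZ} μ = h L_Z μ + (Z h) μ`, evaluated on a frame. -/
theorem lieDerivative_smul {h : X → ℝ} {Z : ∀ x : X, TangentSpace 𝓘(ℝ, E) x} {x : X}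
    [CompleteSpace E] (hh : MDifferentiableAt 𝓘(ℝ, E) 𝓘(ℝ, ℝ) h x)
    (hZ : MDifferentiableAt 𝓘(ℝ, E) 𝓘(ℝ, E).tangent
      (fun x => (TotalSpace.mk' E x (Z x) : TangentBundle 𝓘(ℝ, E) X)) x)
    (μ : TopForm E X) {Y : Fin (Module.finrank ℝ E) → ∀ x : X, TangentSpace 𝓘(ℝ, E) x}
    (e : Module.Basis (Fin (Module.finrank ℝ E)) ℝ (TangentSpace 𝓘(ℝ, E) x))
    (he : ∀ i, Y i x = e i) :
    lieDerivative (h • Z) μ Y x = h x * lieDerivative Z μ Y x +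
      (differential h x : TangentSpace 𝓘(ℝ, E) x →L[ℝ] ℝ) (Z x) * μ x (fun i => Y i x) := by
  have : IsManifold 𝓘(ℝ, E) 2 X := IsManifold.of_le (n := ∞)
    (WithTop.coe_le_coe.2 (le_top : (2 : ℕ∞) ≤ ⊤))
  have hYe : (fun i => Y i x) = e := funext he
  have hb : ∀ i, VectorField.mlieBracket 𝓘(ℝ, E) (h • Z) (Y i) x =
      (-(differential h x : TangentSpace 𝓘(ℝ, E) x →L[ℝ] ℝ) (e i)) • Z x +
        h x • VectorField.mlieBracket 𝓘(ℝ, E) Z (Y i) x := fun i => by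
    rw [VectorField.mlieBracket_smul_left hh hZ, he i]
    rfl
  -- The terms `-(Y_i h) Z` of `[hZ, Y_i]` put `Z` into the `i`-th slot; the trace identity sums
  -- their contributions to `(Z h) μ(Y)`.
  have htr := sum_smul_alternating_update e (μ x)
    (differential h x : TangentSpace 𝓘(ℝ, E) x →L[ℝ] ℝ).toLinearMap (Z x)
  simp only [ContinuousLinearMap.coe_coe] at htr
  simp only [lieDerivative, hb, Pi.smul_apply', hYe, AlternatingMap.map_update_add,
    AlternatingMap.map_update_smul, Finset.sum_add_distrib, smul_eq_mul, map_smul, neg_mul,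
    Finset.sum_neg_distrib, htr, ← Finset.mul_sum]
  ring

theorem lieDerivative_sum_smul {ι : Type*} (s : Finset ι) {h : ι → X → ℝ}
    {Z : ι → ∀ x : X, TangentSpace 𝓘(ℝ, E) x} {x : X}
    [CompleteSpace E] (hh : ∀ j, MDifferentiableAt 𝓘(ℝ, E) 𝓘(ℝ, ℝ) (h j) x)
    (hZ : ∀ j, MDifferentiableAt 𝓘(ℝ, E) 𝓘(ℝ, E).tangent
      (fun x => (TotalSpace.mk' E x (Z j x) : TangentBundle 𝓘(ℝ, E) X)) x)
    (μ : TopForm E X) {Y : Fin (Module.finrank ℝ E) → ∀ x : X, TangentSpace 𝓘(ℝ, E) x}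
    (e : Module.Basis (Fin (Module.finrank ℝ E)) ℝ (TangentSpace 𝓘(ℝ, E) x))
    (he : ∀ i, Y i x = e i) :
    lieDerivative (∑ j ∈ s, h j • Z j) μ Y x = ∑ j ∈ s, (h j x * lieDerivative (Z j) μ Y x +
      (differential (h j) x : TangentSpace 𝓘(ℝ, E) x →L[ℝ] ℝ) (Z j x) *
        μ x (fun i => Y i x)) := by
  classical
  have hs : ∀ j, MDifferentiableAt 𝓘(ℝ, E) 𝓘(ℝ, E).tangent
      (fun x => (TotalSpace.mk' E x ((h j • Z j) x) : TangentBundle 𝓘(ℝ, E) X)) x :=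
    fun j => (hh j).smul_section (hZ j)
  induction s using Finset.induction_on with
  | empty => simpa using lieDerivative_zero μ Y x
  | insert j s hj ih =>
    rw [Finset.sum_insert hj, Finset.sum_insert hj, ← ih, ← lieDerivative_smul (hh j) (hZ j) μ e he]
    refine lieDerivative_add (hs j) ?_ μ Y
    simpa only [Finset.sum_apply] using MDifferentiableAt.sum_section fun i _ => hs i

end LieDerivative

/-! ### Lifting Hamiltonian and modular vector fields to the algebroid -/

section Lift

variable {E : Type*} [NormedAddCommGroup E] [NormedSpace ℝ E] [FiniteDimensional ℝ E]
  {X : Type*} [TopologicalSpace X] [T2Space X] [ChartedSpace E X] [IsManifold 𝓘(ℝ, E) ∞ X]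
  {F : Type*} [NormedAddCommGroup F] [NormedSpace ℝ F]
  {V : X → Type*} [TopologicalSpace (TotalSpace F V)]
  [∀ x, AddCommGroup (V x)] [∀ x, Module ℝ (V x)] [∀ x, TopologicalSpace (V x)]
  [FiberBundle F V] [VectorBundle ℝ F V]

/-- Every point has a neighbourhood on which global smooth vector fields form the frame of a local
trivialization of the tangent bundle. -/
theorem exists_global_frame (x : X) :
    ∃ Y : Fin (Module.finrank ℝ E) → ∀ x : X, TangentSpace 𝓘(ℝ, E) x,
      (∀ i, Y i ∈ vectorFields univ) ∧ ∀ᶠ y in 𝓝 x,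
        ∃ e : Module.Basis (Fin (Module.finrank ℝ E)) ℝ (TangentSpace 𝓘(ℝ, E) y),
          ∀ i, Y i y = e i := by
  let b := Module.finBasis ℝ E
  let e := trivializationAt E (TangentSpace 𝓘(ℝ, E) : X → Type _) x
  have hx : x ∈ e.baseSet := FiberBundle.mem_baseSet_trivializationAt' x
  -- The fields are extended globally so that they can be fed to a volume form on any `W`; they need
  -- to be a frame only near `x`.
  choose σ hσ using fun i => exists_contMDiffSection_eventuallyEq (E := E) (F := E)
    e.open_baseSet (e.contMDiffOn_localFrame_baseSet ∞ b i) hx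
  refine ⟨fun i => σ i, fun i => (σ i).contMDiff.contMDiffOn, ?_⟩
  filter_upwards [eventually_all.2 hσ, e.open_baseSet.mem_nhds hx] with y hy hye
  exact ⟨e.basisAt b hye, fun i => by
    rw [hy i, Trivialization.localFrame_apply_of_mem_baseSet]⟩

namespace LieAlgebroid

variable (A : LieAlgebroid E F V)

/-- The factors are made global sections because the algebroid bracket, needed for `[u_k, v_k]`, is
defined only on those. -/
theorem AdmitsLift.eventually_eq_sum_wedge {A : LieAlgebroid E F V} {p : Bivector E X}
    (hlift : A.AdmitsLift p) (x : X) :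
    ∃ (m : ℕ) (u v : Fin m → Cₛ^∞⟮𝓘(ℝ, E); F, V⟯), ∀ᶠ y in 𝓝 x,
      p y = ∑ k, wedge (A.anchor y (u k y)) (A.anchor y (v k y)) := by
  obtain ⟨q, hq, hqp⟩ := hlift
  obtain ⟨W, hW, hx, m, s, t, hs, ht, hst⟩ := hq x
  choose u hu using fun k => exists_contMDiffSection_eventuallyEq hW (hs k) hx
  choose v hv using fun k => exists_contMDiffSection_eventuallyEq hW (ht k) hx
  refine ⟨m, u, v, ?_⟩
  filter_upwards [hW.mem_nhds hx, eventually_all.2 hu, eventually_all.2 hv] with y hy huy hvy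
  rw [← hqp y, hst y hy, map_sum]
  simp only [map_wedge, huy, hvy]

variable {A} {p : Bivector E X} {m : ℕ} {u v : Fin m → Cₛ^∞⟮𝓘(ℝ, E); F, V⟯}

omit [FiniteDimensional ℝ E] [T2Space X] in
theorem hamiltonian_eq_sum {y : X}
    (hp : p y = ∑ k, wedge (A.anchor y (u k y)) (A.anchor y (v k y))) (f : X → ℝ) :
    hamiltonian p f y = ∑ k, (A.act (u k) f y • A.anchor y (v k y) -
      A.act (v k) f y • A.anchor y (u k y)) := by
  rw [hamiltonian, hp, sharp_sum]
  simp only [sharp_wedge]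
  rfl

omit [FiniteDimensional ℝ E] [T2Space X] in
theorem exists_section_of_isHamiltonianOn {Z : ∀ x : X, TangentSpace 𝓘(ℝ, E) x} {W : Set X}
    (hW : IsOpen W) (hp : ∀ y ∈ W, p y = ∑ k, wedge (A.anchor y (u k y)) (A.anchor y (v k y)))
    (hZ : IsHamiltonianOn p Z W) :
    ∃ s : ∀ x, V x, IsSmoothSectionOn E F V s W ∧ ∀ y ∈ W, A.anchor y (s y) = Z y := by
  obtain ⟨f, hf, hZ⟩ := hZ
  have hact : ∀ w : Cₛ^∞⟮𝓘(ℝ, E); F, V⟯, IsSmoothFunctionOn E (A.act w f) W := fun w =>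
    isSmoothFunctionOn_differential hW hf (A.anchor_mem_vectorFields w.contMDiff.contMDiffOn)
  refine ⟨fun y => ∑ k, (A.act (u k) f • ⇑(v k) - A.act (v k) f • ⇑(u k)) y, ?_, fun y hy => ?_⟩
  · exact ContMDiffOn.sum_section fun k _ =>
      ((hact (u k)).smul_section (v k).contMDiff.contMDiffOn).sub_section
        ((hact (v k)).smul_section (u k).contMDiff.contMDiffOn)
  · rw [hZ y hy, hamiltonian_eq_sum (hp y hy)]
    simp

variable [ContMDiffVectorBundle ∞ F V 𝓘(ℝ, E)]

/-- The core computation: `∑ (div v_k) u_k - (div u_k) v_k - [u_k, v_k]` is a preimage of the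
modular vector field. The modular identity is used on `W`, the decomposition of `p` and the frame
only on `W'`. -/
theorem exists_section_of_isModularVectorFieldOn {Z : ∀ x : X, TangentSpace 𝓘(ℝ, E) x}
    {W W' : Set X} (hW : IsOpen W) (hW' : IsOpen W') (hWW : W' ⊆ W)
    (hp : ∀ y ∈ W', p y = ∑ k, wedge (A.anchor y (u k y)) (A.anchor y (v k y)))
    {μ : TopForm E X} (hμ : IsVolumeFormOn μ W) (hZ : IsModularVectorFieldOn p μ Z W)
    {Y : Fin (Module.finrank ℝ E) → ∀ x : X, TangentSpace 𝓘(ℝ, E) x}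
    (hY : ∀ i, Y i ∈ vectorFields univ)
    (he : ∀ y ∈ W', ∃ e : Module.Basis (Fin (Module.finrank ℝ E)) ℝ (TangentSpace 𝓘(ℝ, E) y),
      ∀ i, Y i y = e i) :
    ∃ s : ∀ x, V x, IsSmoothSectionOn E F V s W' ∧ ∀ y ∈ W', A.anchor y (s y) = Z y := by
  have : CompleteSpace E := FiniteDimensional.complete ℝ E
  have hYW : ∀ i, Y i ∈ vectorFields W := fun i => vectorFields_mono (hY i) (subset_univ W)
  let vol : X → ℝ := fun y => μ y fun i => Y i y
  have hvol : ∀ y ∈ W', vol y ≠ 0 := by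
    intro y hy
    obtain ⟨e, he⟩ := he y hy
    change μ y (fun i => Y i y) ≠ 0
    rw [funext he, AlternatingMap.map_basis_ne_zero_iff]
    exact hμ.2 y (hWW hy)
  -- The divergence of `ρ(w)` with respect to `μ`, read off on the frame `Y`.
  let div : (∀ x : X, V x) → X → ℝ := fun w y =>
    lieDerivative (fun x => A.anchor x (w x)) μ Y y / vol y
  have hdiv : ∀ w : Cₛ^∞⟮𝓘(ℝ, E); F, V⟯, IsSmoothFunctionOn E (div w) W' := fun w =>
    ((isSmoothFunctionOn_lieDerivative hW hμ
      (A.anchor_mem_vectorFields w.contMDiff.contMDiffOn) hYW).mono hWW).div₀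
      ((hμ.1 Y hYW).mono hWW) hvol
  have hdiv_mul : ∀ (w : ∀ x, V x), ∀ y ∈ W',
      lieDerivative (fun x => A.anchor x (w x)) μ Y y = div w y * vol y := fun w y hy =>
    (div_mul_cancel₀ _ (hvol y hy)).symm
  refine ⟨fun y => ∑ k, (div (v k) • ⇑(u k) - div (u k) • ⇑(v k) - ⇑(A.bracket (u k) (v k))) y,
    ContMDiffOn.sum_section fun k _ => (((hdiv (v k)).smul_section
      (u k).contMDiff.contMDiffOn).sub_section ((hdiv (u k)).smul_section
        (v k).contMDiff.contMDiffOn)).sub_section (A.bracket (u k) (v k)).contMDiff.contMDiffOn,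
    fun y hy => tangent_ext fun f hf => ?_⟩
  obtain ⟨e, he⟩ := he y hy
  have hL := hZ.2 f hf.contMDiffOn Y hYW y (hWW hy)
  -- Indexing by `Fin m ⊕ Fin m`, with signs moved into the coefficients, gives the shape required
  -- by `lieDerivative_sum_smul`.
  have hham : ∀ᶠ z in 𝓝 y, hamiltonian p f z =
      (∑ j, (Sum.elim (fun k => A.act (u k) f) (fun k => -A.act (v k) f) j : X → ℝ) •
        (Sum.elim (fun k x => A.anchor x (v k x)) (fun k x => A.anchor x (u k x)) j :
          ∀ x : X, TangentSpace 𝓘(ℝ, E) x)) z := by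
    filter_upwards [hW'.mem_nhds hy] with z hz
    rw [hamiltonian_eq_sum (hp z hz)]
    simp [Finset.sum_apply, Finset.sum_add_distrib, sub_eq_add_neg]
  have hd : ∀ {g : X → ℝ}, ContMDiff 𝓘(ℝ, E) 𝓘(ℝ, ℝ) ∞ g →
      MDifferentiableAt 𝓘(ℝ, E) 𝓘(ℝ, ℝ) g y := fun hg => hg.mdifferentiableAt (by simp)
  have hda : ∀ w : Cₛ^∞⟮𝓘(ℝ, E); F, V⟯, MDifferentiableAt 𝓘(ℝ, E) 𝓘(ℝ, E).tangent
      (fun x => (TotalSpace.mk' E x (A.anchor x (w x)) : TangentBundle 𝓘(ℝ, E) X)) y := fun w =>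
    mdifferentiableAt_of_mem_vectorFields isOpen_univ
      (A.anchor_mem_vectorFields w.contMDiff.contMDiffOn) (mem_univ y)
  have hneg : ∀ g : X → ℝ, differential (E := E) (-g) y = -differential g y := fun g => mfderiv_neg
  rw [lieDerivative_congr hham, lieDerivative_sum_smul _ ?_ ?_ μ e he, Fintype.sum_sum_type] at hL
  · simp only [Sum.elim_inl, Sum.elim_inr, hdiv_mul _ y hy, Pi.neg_apply, hneg] at hL
    refine mul_right_cancel₀ (hvol y hy) (Eq.trans ?_ hL)
    rw [← Finset.sum_add_distrib, map_sum, map_sum, Finset.sum_mul]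
    refine Finset.sum_congr rfl fun k _ => ?_
    -- This trades the second-order terms in `f` for the derivative along `[u_k, v_k]`.
    have hb := A.act_bracket (u k) (v k) hf y
    simp only [act] at hb
    simp only [Pi.sub_apply, Pi.smul_apply', map_sub, map_smul, smul_eq_mul, hb]
    simp only [act, vol, neg_apply]
    ring
  · rintro (k | k)
    · exact hd (A.contMDiff_act (u k) hf)
    · exact (hd (A.contMDiff_act (v k) hf)).neg
  · rintro (k | k)
    · exact hda (v k)
    · exact hda (u k)

/-- Each generator has a preimage near each point. The preimages of `Z x` under the anchor form a
convex set, so local choices glue over `U`. -/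
theorem modularFoliation_subset_foliation [SecondCountableTopology X] (hlift : A.AdmitsLift p)
    {U : Set X} (hU : IsOpen U) : modularFoliation p U ⊆ A.foliation U := by
  intro Z hZ
  suffices h : ∃ s : ∀ x, V x, IsSmoothSectionOn E F V s U ∧
      ∀ x ∈ U, s x ∈ {w | A.anchor x w = Z x} by
    obtain ⟨s, hs, hsZ⟩ := h
    exact ⟨s, hs, fun x hx => (hsZ x hx).symm⟩
  refine exists_isSmoothSectionOn_forall_mem_convex hU _
    (fun x => (convex_singleton (Z x)).linear_preimage (A.anchor x)) fun x hx => ?_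
  obtain ⟨W, hW, hxW, -, n, g, T, hg, hT, hZT⟩ := hZ x hx
  obtain ⟨m, u, v, huv⟩ := hlift.eventually_eq_sum_wedge x
  obtain ⟨Y, hY, hYe⟩ := exists_global_frame (E := E) x
  obtain ⟨W', hW'W, hW', hxW'⟩ := mem_nhds_iff.1 (inter_mem (hW.mem_nhds hxW) (huv.and hYe))
  have hsec : ∀ k, ∃ s : ∀ x, V x, IsSmoothSectionOn E F V s W' ∧
      ∀ y ∈ W', A.anchor y (s y) = T k y := by
    intro k
    rcases hT k with ⟨f, hf, hTf⟩ | ⟨μ, hμ, hTμ⟩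
    · exact exists_section_of_isHamiltonianOn hW' (fun y hy => (hW'W hy).2.1)
        ⟨f, hf.mono fun y hy => (hW'W hy).1, fun y hy => hTf y (hW'W hy).1⟩
    -- Unlike the Hamiltonian case, the data stay on `W`: the modular condition is tested against
    -- functions on all of `W`, and not every function on `W'` extends.
    · exact exists_section_of_isModularVectorFieldOn hW hW' (fun y hy => (hW'W hy).1)
        (fun y hy => (hW'W hy).2.1) hμ hTμ hY fun y hy => (hW'W hy).2.2
  choose s hs hsT using hsec
  refine ⟨W', hW', hxW', fun y => ∑ k, (g k • s k) y, ContMDiffOn.sum_section fun k _ =>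
    ((hg k).mono fun y hy => (hW'W hy).1).smul_section (hs k), fun y hy => ?_⟩
  rw [mem_ofPred_eq, map_sum, hZT y (hW'W hy).1]
  refine Finset.sum_congr rfl fun k _ => ?_
  rw [Pi.smul_apply', map_smul, hsT k y hy]

end LieAlgebroid

end Lift

end PoissonLift

end

theorem theoremC
    {E : Type*} [NormedAddCommGroup E] [NormedSpace ℝ E] [FiniteDimensional ℝ E]
    {X : Type*} [TopologicalSpace X] [T2Space X] [SecondCountableTopology X]
    [ChartedSpace E X] [IsManifold 𝓘(ℝ, E) ∞ X]
    {F : Type*} [NormedAddCommGroup F] [NormedSpace ℝ F] [FiniteDimensional ℝ F]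
    {V : X → Type*} [TopologicalSpace (Bundle.TotalSpace F V)]
    [∀ x, AddCommGroup (V x)] [∀ x, Module ℝ (V x)] [∀ x, TopologicalSpace (V x)]
    [FiberBundle F V] [VectorBundle ℝ F V] [ContMDiffVectorBundle ∞ F V 𝓘(ℝ, E)]
    (A : PoissonLift.LieAlgebroid E F V)
    (π : PoissonLift.Bivector E X) (hπ : PoissonLift.IsPoisson π) (hlift : A.AdmitsLift π) :
    (∀ U : Set X, IsOpen U →
      PoissonLift.symplecticFoliation π U ⊆ PoissonLift.modularFoliation π U ∧
      PoissonLift.modularFoliation π U ⊆ A.foliation U ∧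
      A.foliation U ⊆ PoissonLift.vectorFields U) ∧
    ∀ S : PoissonLift.ImmersedSubmanifold E X, A.IsOrbit S → S.IsPoissonSubmanifold π := by
  refine ⟨fun U hU => ⟨PoissonLift.symplecticFoliation_subset_modularFoliation π hU,
    PoissonLift.LieAlgebroid.modularFoliation_subset_foliation hlift hU,
    A.foliation_subset_vectorFields U⟩, fun S hS => A.isPoissonSubmanifold hlift hS.1⟩
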